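/- For $n\ge 0$ let $A_n=\sum_{k=0}^{n}\binom{n}{k}^2\binom{n+k}{k}^2$ be the $n$-th Apéry number. For every integer $r\ge 0$ there is a rational number $c_r$, depending only on $r$, such that for every prime $p>3$ the number $c_r$ is a $p$-adic integer (that is, $p$ does not divide its denominator) and $$\sum_{k=0}^{p-1}(2k+1)^{2r+1}(-1)^kA_k\equiv c_r\,p\left(\frac{p}{3}\right)\pmod{p^3}$$ in the ring $\mathbb{Z}_p$ of $p$-adic integers, where $\left(\frac{\cdot}{3}\right)$ denotes the Legendre symbol modulo $3$. -/

import Mathlib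

/-- The Apéry number `A_n = ∑_{k=0}^{n} C(n,k)^2 C(n+k,k)^2`. -/
def aperyNumber (n : ℕ) : ℕ :=
  ∑ k ∈ Finset.range (n + 1), (n.choose k) ^ 2 * ((n + k).choose k) ^ 2

/-! Write χ for the Legendre symbol mod 3 and f_k for the Franel numbers. For r = 0, expand A_n = ∑
C(n,k) C(n+k,k) f_k (`aperyNumber_eq_sum_franelNumber`). The sum over n then has the closed form
(p-k) C(p,k) C(p+k,k), which is p(-1)^k mod p^3, leaving p ∑ (-1)^k f_k. Mod p^2 that alternating
sum is ∑ C(2j,j) (`alternating_sum_franelNumber_modEq`), which is χ(p) (`sum_centralBinom_modEq`).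

For larger r, summing the Apéry recurrence by parts against (2k+1)^(2r) leaves a boundary term
divisible by p^3 (`sum_apery_operator`). This makes 36 times moment r+1 an integer combination of
lower moments, with coefficients independent of p. Since 36 is a unit for p > 3, induction gives
c_r, starting from c_0 = 1. -/

/-! ### Sums of central binomial coefficients mod p^2. -/

theorem legendreSym_three_sum (a : ℤ) :
    legendreSym 3 (a - 1) + legendreSym 3 a + legendreSym 3 (a + 1) = 0 := by
  rw [legendreSym.mod 3 (a - 1), legendreSym.mod 3 a, legendreSym.mod 3 (a + 1)]
  have h : a % 3 = 0 ∨ a % 3 = 1 ∨ a % 3 = 2 := by omega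
  rcases h with h | h | h
  · have h1 : (a - 1) % 3 = 2 := by omega
    have h2 : (a + 1) % 3 = 1 := by omega
    push_cast
    rw [h, h1, h2]; decide
  · have h1 : (a - 1) % 3 = 0 := by omega
    have h2 : (a + 1) % 3 = 2 := by omega
    push_cast
    rw [h, h1, h2]; decide
  · have h1 : (a - 1) % 3 = 1 := by omega
    have h2 : (a + 1) % 3 = 0 := by omega
    push_cast
    rw [h, h1, h2]; decide

theorem legendreSym_three_neg (a : ℤ) : legendreSym 3 (-a) = -legendreSym 3 a := by
  rw [neg_eq_neg_one_mul, legendreSym.mul]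
  have : legendreSym 3 (-1) = -1 := by decide
  rw [this]; ring

/-- With S the shift a ↦ a - 1, the sum is (1 + S)^n χ, and 1 + S = -S^2 on χ because three
consecutive values cancel. -/
theorem sum_choose_mul_legendreSym_three (n : ℕ) (a : ℤ) :
    ∑ k ∈ Finset.range (n + 1), (n.choose k : ℤ) * legendreSym 3 (a - k) =
      (-1) ^ n * legendreSym 3 (a - 2 * n) := by
  induction n generalizing a with
  | zero => simp
  | succ n ih =>
    rw [Finset.sum_range_succ']
    have h1 : ∀ k ∈ Finset.range (n + 1),
        (((n + 1).choose (k + 1) : ℕ) : ℤ) * legendreSym 3 (a - ((k + 1 : ℕ) : ℤ)) =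
        (n.choose k : ℤ) * legendreSym 3 ((a - 1) - k) +
        (n.choose (k + 1) : ℤ) * legendreSym 3 (a - ((k + 1 : ℕ) : ℤ)) := by
      intro k _
      rw [Nat.choose_succ_succ]
      have : a - ((k + 1 : ℕ) : ℤ) = a - 1 - k := by push_cast; ring
      rw [this]; push_cast; ring
    have h2 := ih a
    rw [Finset.sum_range_succ'] at h2
    have h3 : ∑ k ∈ Finset.range (n + 1),
        (n.choose (k + 1) : ℤ) * legendreSym 3 (a - ((k + 1 : ℕ) : ℤ)) =
        ∑ k ∈ Finset.range n,
        (n.choose (k + 1) : ℤ) * legendreSym 3 (a - ((k + 1 : ℕ) : ℤ)) := by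
      rw [Finset.sum_range_succ]; simp
    rw [Finset.sum_congr rfl h1, Finset.sum_add_distrib, ih (a - 1), h3]
    have h4 := legendreSym_three_sum (a - 2 * n - 1)
    have e1 : a - 2 * (n : ℤ) - 1 - 1 = a - 2 * ((n + 1 : ℕ) : ℤ) := by push_cast; ring
    have e2 : a - 2 * (n : ℤ) - 1 + 1 = a - 2 * n := by ring
    have e3 : a - 1 - 2 * (n : ℤ) = a - 2 * n - 1 := by ring
    rw [e1, e2] at h4
    rw [e3]
    simp only [Nat.choose_zero_right] at h2 ⊢
    rw [pow_succ]
    linear_combination h2 + (-1) ^ n * h4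

theorem sum_choose_prime_mul_legendreSym_three {p : ℕ} (hp : Odd p) :
    ∑ k ∈ Finset.range p, (p.choose k : ℤ) * legendreSym 3 (p - k) = legendreSym 3 p := by
  have h := sum_choose_mul_legendreSym_three p p
  rw [Finset.sum_range_succ, hp.neg_one_pow] at h
  have e : (p : ℤ) - 2 * p = -p := by ring
  rw [e, legendreSym_three_neg] at h
  simpa [legendreSym.at_zero] using h

theorem sum_centralBinom_eq (n : ℕ) :
    ∑ k ∈ Finset.range n, ((2 * k).choose k : ℤ) =
      ∑ d ∈ Finset.range n, ((2 * n).choose (n + (d + 1)) : ℤ) * legendreSym 3 (d + 1 : ℤ) := by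
  have ext : ∀ n : ℕ, ∀ m, n ≤ m →
      ∑ d ∈ Finset.range n, ((2 * n).choose (n + (d + 1)) : ℤ) * legendreSym 3 (d + 1 : ℤ) =
      ∑ d ∈ Finset.range m, ((2 * n).choose (n + (d + 1)) : ℤ) * legendreSym 3 (d + 1 : ℤ) := by
    intro n m hm
    apply Finset.sum_subset (Finset.range_mono hm)
    intro d _ hd
    rw [Finset.mem_range, not_lt] at hd
    rw [Nat.choose_eq_zero_of_lt (by omega)]; simp
  induction n with
  | zero => simp
  | succ n ih =>
    -- Padding both sums to length n + 2 makes the boundary terms of `tele` vanish, except f 0 =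
    -- C(2n,n).
    rw [Finset.sum_range_succ, ih, ext n (n + 2) (by omega)]
    set f : ℕ → ℤ := fun d => ((2 * n).choose (n + d) : ℤ) with hf
    have hs : ∀ d : ℕ, ((2 * (n + 1)).choose (n + 1 + (d + 1)) : ℤ) =
        f d + 2 * f (d + 1) + f (d + 2) := by
      intro d
      have e1 : 2 * (n + 1) = 2 * n + 1 + 1 := by ring
      have e2 : n + 1 + (d + 1) = n + d + 1 + 1 := by ring
      simp only [hf]
      rw [e1, e2, Nat.choose_succ_succ, Nat.choose_succ_succ, Nat.choose_succ_succ,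
        ← add_assoc n d 1, ← add_assoc n d 2]
      push_cast; ring
    have hz : ∀ d, n < d → f d = 0 := by
      intro d hd
      simp only [hf]
      rw [Nat.choose_eq_zero_of_lt (by omega)]; simp
    have hc : ((2 * n).choose n : ℤ) = f 0 := by simp [hf]
    have tele : ∀ m : ℕ, ∑ d ∈ Finset.range m,
        ((f d + 2 * f (d + 1) + f (d + 2)) - f (d + 1)) * legendreSym 3 (d + 1 : ℤ) =
        f 0 - f m * legendreSym 3 (m + 1 : ℤ) + f (m + 1) * legendreSym 3 (m : ℤ) := by
      intro m
      induction m with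
      | zero => simp [legendreSym.at_zero, legendreSym.at_one]
      | succ m ihm =>
        rw [Finset.sum_range_succ, ihm]
        have := legendreSym_three_sum ((m : ℤ) + 1)
        have e : (m : ℤ) + 1 - 1 = m := by ring
        rw [e] at this
        push_cast
        linear_combination f (m + 1) * this
    have h1 := tele (n + 2)
    rw [hz (n + 2) (by omega), hz (n + 2 + 1) (by omega)] at h1
    rw [ext (n + 1) (n + 2) (by omega), hc]
    simp only [hs]
    simp only [sub_mul, Finset.sum_sub_distrib] at h1
    change ∑ d ∈ Finset.range (n + 2), f (d + 1) * _ + _ = _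
    linarith

/-- By Vandermonde, C(2p,k) ≡ 2 C(p,k) mod p^2 for 0 < k < p: every non-extreme term has two factors
p. -/
theorem sum_centralBinom_modEq {p : ℕ} (hp : p.Prime) (h2 : p ≠ 2) :
    (p : ℤ) ^ 2 ∣ ∑ k ∈ Finset.range p, ((2 * k).choose k : ℤ) - legendreSym 3 p := by
  have hodd : Odd p := hp.odd_of_ne_two h2
  have hre : ∑ k ∈ Finset.range p, ((2 * k).choose k : ℤ) =
      ∑ k ∈ Finset.range p, ((2 * p).choose k : ℤ) * legendreSym 3 (p - k) := by
    rw [sum_centralBinom_eq, ← Finset.sum_range_reflect]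
    apply Finset.sum_congr rfl
    intro k hk
    rw [Finset.mem_range] at hk
    have e1 : p + (p - 1 - k + 1) = 2 * p - k := by omega
    have e2 : ((p - 1 - k : ℕ) : ℤ) + 1 = p - k := by omega
    rw [e1, e2, Nat.choose_symm (by omega)]
  have hch : ∀ k, 0 < k → k < p → (p : ℤ) ^ 2 ∣ ((2 * p).choose k : ℤ) - 2 * (p.choose k : ℤ) := by
    intro k hk hkp
    rw [two_mul, Nat.add_choose_eq, Finset.Nat.sum_antidiagonal_eq_sum_range_succ
      (fun i j => p.choose i * p.choose j)]
    obtain ⟨k, rfl⟩ : ∃ l, k = l + 1 := ⟨k - 1, by omega⟩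
    rw [Finset.sum_range_succ, Finset.sum_range_succ']
    push_cast
    simp only [Nat.choose_zero_right, Nat.sub_self, Nat.cast_one]
    have : ∀ x a : ℤ, x + 1 * a + a * 1 - 2 * a = x := by intros; ring
    rw [this]
    apply Finset.dvd_sum
    intro i hi
    rw [Finset.mem_range] at hi
    rw [sq]
    apply mul_dvd_mul
    · exact_mod_cast hp.dvd_choose_self (by omega) (by omega)
    · exact_mod_cast hp.dvd_choose_self (by omega) (by omega)
  have hsum := sum_choose_prime_mul_legendreSym_three hodd
  rw [hre]
  have hpos := hp.pos
  obtain ⟨q, rfl⟩ : ∃ q, p = q + 1 := ⟨p - 1, by omega⟩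
  rw [Finset.sum_range_succ'] at hsum ⊢
  simp only [Nat.choose_zero_right, Nat.cast_zero, sub_zero, Nat.cast_one, one_mul] at hsum ⊢
  -- The k = 0 term is already χ(p), so the rest of the C(p,k) sum cancels; 2 C(p,k) may thus be
  -- subtracted freely.
  have h0 : ∑ k ∈ Finset.range q, ((q + 1).choose (k + 1) : ℤ) *
      legendreSym 3 (((q + 1 : ℕ) : ℤ) - ((k + 1 : ℕ) : ℤ)) = 0 := by linarith
  rw [add_sub_cancel_right]
  have : ∑ k ∈ Finset.range q, ((2 * (q + 1)).choose (k + 1) : ℤ) *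
      legendreSym 3 (((q + 1 : ℕ) : ℤ) - ((k + 1 : ℕ) : ℤ)) =
      ∑ k ∈ Finset.range q, (((2 * (q + 1)).choose (k + 1) : ℤ) - 2 * ((q + 1).choose (k + 1) : ℤ))
        * legendreSym 3 (((q + 1 : ℕ) : ℤ) - ((k + 1 : ℕ) : ℤ)) := by
    simp only [sub_mul, Finset.sum_sub_distrib, mul_assoc, ← Finset.mul_sum]
    rw [h0]; ring
  rw [this]
  apply Finset.dvd_sum
  intro k hk
  rw [Finset.mem_range] at hk
  exact Dvd.dvd.mul_right (hch (k + 1) (by omega) (by omega)) _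

/-! ### Alternating sums of Franel numbers. -/

/-- This is the a-th finite difference of x ↦ C(x,c) at b. -/
theorem alternating_sum_choose_mul_choose (a b c : ℕ) (h : a ≤ c) :
    ∑ i ∈ Finset.range (a + 1), (-1 : ℤ) ^ i * (a.choose i : ℤ) * ((b + i).choose c : ℤ) =
      (-1) ^ a * (b.choose (c - a) : ℤ) := by
  induction a generalizing b with
  | zero => simp
  | succ a ih =>
    rw [Finset.sum_range_succ']
    have h1 : ∀ i ∈ Finset.range (a + 1), (-1 : ℤ) ^ (i + 1) * ((a + 1).choose (i + 1) : ℤ) *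
        ((b + (i + 1)).choose c : ℤ) =
        -((-1 : ℤ) ^ i * (a.choose i : ℤ) * ((b + 1 + i).choose c : ℤ)) +
        (-1 : ℤ) ^ (i + 1) * (a.choose (i + 1) : ℤ) * ((b + (i + 1)).choose c : ℤ) := by
      intro i _
      rw [Nat.choose_succ_succ, show b + 1 + i = b + (i + 1) by ring]
      push_cast; ring
    have h2 := ih b (by omega)
    rw [Finset.sum_range_succ'] at h2
    rw [Finset.sum_congr rfl h1, Finset.sum_add_distrib, Finset.sum_neg_distrib,
      ih (b + 1) (by omega), Finset.sum_range_succ (fun i => (-1 : ℤ) ^ (i + 1) *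
        (a.choose (i + 1) : ℤ) * ((b + (i + 1)).choose c : ℤ))]
    have e : c - a = c - (a + 1) + 1 := by omega
    rw [e] at h2 ⊢
    rw [Nat.choose_succ_succ]
    simp only [Nat.choose_succ_self, Nat.choose_zero_right] at h2 ⊢
    rw [pow_succ]
    push_cast at h2 ⊢
    linear_combination h2

/-- The Franel numbers, in the form `∑ j, C(k,j)^2 C(2j,k)`. -/
def franelNumber (k : ℕ) : ℕ :=
  ∑ j ∈ Finset.range (k + 1), (k.choose j) ^ 2 * (2 * j).choose k

theorem franelNumber_eq_sum_range {k m : ℕ} (h : k < m) :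
    franelNumber k = ∑ j ∈ Finset.range m, (k.choose j) ^ 2 * (2 * j).choose k := by
  apply Finset.sum_subset (Finset.range_mono h)
  intro j _ hj
  rw [Finset.mem_range, not_lt] at hj
  rw [Nat.choose_eq_zero_of_lt (by omega)]; simp

theorem choose_sq_mul_choose (j i : ℕ) :
    ((j + i).choose j) ^ 2 * (2 * j).choose (j + i) =
      (2 * j).choose j * ((j + i).choose j * j.choose i) := by
  by_cases h : i ≤ j
  · have := Nat.choose_mul (n := 2 * j) (k := j + i) (s := j) (by omega)
    rw [show 2 * j - j = j by omega, show j + i - j = i by omega] at this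
    rw [sq, mul_assoc, mul_comm ((j + i).choose j) ((2 * j).choose (j + i)), this]; ring
  · rw [Nat.choose_eq_zero_of_lt (show 2 * j < j + i by omega),
      Nat.choose_eq_zero_of_lt (show j < i by omega)]; simp

theorem alternating_sum_franel_inner {m j : ℕ} (h : 2 * j < m) :
    ∑ k ∈ Finset.range m, (-1 : ℤ) ^ k * (((k.choose j) ^ 2 * (2 * j).choose k : ℕ) : ℤ) =
      ((2 * j).choose j : ℤ) := by
  have hs : ∑ k ∈ Finset.range m, (-1 : ℤ) ^ k * (((k.choose j) ^ 2 * (2 * j).choose k : ℕ) : ℤ) =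
      ∑ k ∈ Finset.range (j + (j + 1)),
        (-1 : ℤ) ^ k * (((k.choose j) ^ 2 * (2 * j).choose k : ℕ) : ℤ) := by
    symm
    apply Finset.sum_subset (Finset.range_mono (by omega))
    intro k _ hk
    rw [Finset.mem_range, not_lt] at hk
    rw [Nat.choose_eq_zero_of_lt (show 2 * j < k by omega)]; simp
  rw [hs, Finset.sum_range_add]
  have h0 : ∑ k ∈ Finset.range j,
      (-1 : ℤ) ^ k * (((k.choose j) ^ 2 * (2 * j).choose k : ℕ) : ℤ) = 0 := by
    apply Finset.sum_eq_zero
    intro k hk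
    rw [Finset.mem_range] at hk
    rw [Nat.choose_eq_zero_of_lt hk]; simp
  have h1 := alternating_sum_choose_mul_choose j j j le_rfl
  rw [h0, zero_add]
  simp only [choose_sq_mul_choose]
  simp only [Nat.sub_self, Nat.choose_zero_right, Nat.cast_one, mul_one] at h1
  have h2 : ((-1 : ℤ) ^ j) * (-1) ^ j = 1 := by rw [← mul_pow]; simp
  calc _ = (-1) ^ j * ((2 * j).choose j : ℤ) * ∑ i ∈ Finset.range (j + 1),
        (-1 : ℤ) ^ i * (j.choose i : ℤ) * ((j + i).choose j : ℤ) := by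
        rw [Finset.mul_sum]
        apply Finset.sum_congr rfl
        intro i _
        push_cast; ring
    _ = _ := by rw [h1]; linear_combination ((2 * j).choose j : ℤ) * h2

/-- For fixed j the full sum over k ≤ 2j is exactly C(2j,j). The terms lost by stopping at k < p
contain C(2j,j) and C(k,j), both divisible by p. -/
theorem alternating_sum_franelNumber_modEq {p : ℕ} (hp : p.Prime) :
    (p : ℤ) ^ 2 ∣ ∑ k ∈ Finset.range p, (-1 : ℤ) ^ k * (franelNumber k : ℤ) -
      ∑ j ∈ Finset.range p, ((2 * j).choose j : ℤ) := by
  have h1 : ∑ k ∈ Finset.range p, (-1 : ℤ) ^ k * (franelNumber k : ℤ) =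
      ∑ j ∈ Finset.range p, ∑ k ∈ Finset.range p,
        (-1 : ℤ) ^ k * (((k.choose j) ^ 2 * (2 * j).choose k : ℕ) : ℤ) := by
    rw [Finset.sum_comm]
    apply Finset.sum_congr rfl
    intro k hk
    rw [Finset.mem_range] at hk
    rw [franelNumber_eq_sum_range hk]
    push_cast
    rw [Finset.mul_sum]
  rw [h1, ← Finset.sum_sub_distrib]
  apply Finset.dvd_sum
  intro j hj
  rw [Finset.mem_range] at hj
  rw [← alternating_sum_franel_inner (show 2 * j < p + p by omega), Finset.sum_range_add,
    sub_add_cancel_left, dvd_neg]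
  apply Finset.dvd_sum
  intro t _
  apply Dvd.dvd.mul_left
  by_cases ht : p + t ≤ 2 * j
  · obtain ⟨i, hi⟩ : ∃ i, p + t = j + i := ⟨p + t - j, by omega⟩
    rw [hi, choose_sq_mul_choose, sq]
    have d1 : p ∣ (2 * j).choose j := by
      rw [two_mul]
      exact hp.dvd_choose_add hj hj (by omega)
    have d2 : p ∣ (j + i).choose j := hp.dvd_choose_add hj (by omega) (by omega)
    exact_mod_cast mul_dvd_mul d1 (d2.mul_right _)
  · rw [Nat.choose_eq_zero_of_lt (show 2 * j < p + t by omega)]; simp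

/-! ### Apéry numbers in terms of Franel numbers. -/

theorem sum_choose_mul_choose_mul_choose (m j l : ℕ) (hl : l ≤ m) :
    ∑ i ∈ Finset.range (m + 1), m.choose i * j.choose i * i.choose l =
      m.choose l * (m + j - l).choose m := by
  rw [show m + j - l = j + (m - l) by omega, Nat.add_choose_eq,
    Finset.Nat.sum_antidiagonal_eq_sum_range_succ (fun a b => j.choose a * (m - l).choose b),
    Finset.mul_sum]
  apply Finset.sum_congr rfl
  intro i hi
  rw [Finset.mem_range] at hi
  by_cases h : l ≤ i
  · have := Nat.choose_mul (n := m) (k := i) (s := l) h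
    rw [show m - i = m - l - (i - l) by omega, Nat.choose_symm (by omega)]
    linear_combination (j.choose i) * this
  · rw [Nat.choose_eq_zero_of_lt (show i < l by omega),
      Nat.choose_eq_zero_of_lt (show m - l < m - i by omega)]
    simp

/-- Expand C(x+i,m+j) by Vandermonde, sum over i, then recombine by Vandermonde for x = m + (x-m).
-/
theorem sum_choose_mul_choose_mul_choose_add (m j x : ℕ) (hx : m ≤ x) :
    ∑ i ∈ Finset.range (m + 1), m.choose i * j.choose i * (x + i).choose (m + j) =
      x.choose m * x.choose j := by
  have h1 : ∀ i, (x + i).choose (m + j) =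
      ∑ l ∈ Finset.range (j + (m + 1)), i.choose l * x.choose (m + j - l) := by
    intro i
    rw [add_comm x i, Nat.add_choose_eq,
      Finset.Nat.sum_antidiagonal_eq_sum_range_succ (fun a b => i.choose a * x.choose b),
      show j + (m + 1) = m + j + 1 by ring]
  have h2 : ∀ l, ∑ i ∈ Finset.range (m + 1), m.choose i * j.choose i *
      (i.choose l * x.choose (m + j - l)) =
      m.choose l * ((m + j - l).choose m * x.choose (m + j - l)) := by
    intro l
    simp only [← mul_assoc]
    rw [← Finset.sum_mul]
    by_cases hl : l ≤ m
    · rw [sum_choose_mul_choose_mul_choose m j l hl]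
    · rw [Nat.choose_eq_zero_of_lt (show m < l by omega), Finset.sum_eq_zero]
      · simp
      · intro i hi
        rw [Finset.mem_range] at hi
        rw [Nat.choose_eq_zero_of_lt (show i < l by omega), mul_zero]
  have h3 : x.choose j = ∑ l ∈ Finset.range (j + 1), m.choose l * (x - m).choose (j - l) := by
    conv_lhs => rw [show x = m + (x - m) by omega]
    rw [Nat.add_choose_eq, Finset.Nat.sum_antidiagonal_eq_sum_range_succ
      (fun a b => m.choose a * (x - m).choose b)]
  simp only [h1, Finset.mul_sum]
  rw [Finset.sum_comm]
  simp only [h2]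
  rw [h3, Finset.mul_sum]
  symm
  rw [show j + (m + 1) = j + 1 + m by ring, Finset.sum_range_add _ (j + 1) m]
  symm
  rw [Finset.sum_eq_zero (s := Finset.range m), add_zero]
  · apply Finset.sum_congr rfl
    intro l hl
    rw [Finset.mem_range] at hl
    have := Nat.choose_mul (n := x) (k := m + j - l) (s := m) (by omega)
    rw [show m + j - l - m = j - l by omega] at this
    linear_combination (m.choose l) * this
  · intro i hi
    rw [Finset.mem_range] at hi
    rw [Nat.choose_eq_zero_of_lt (show m + j - (j + 1 + i) < m by omega)]; simp

theorem apery_term_eq_sum (n j : ℕ) (hj : j ≤ n) :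
    (n.choose j) ^ 2 * ((n + j).choose j) ^ 2 =
      ∑ k ∈ Finset.range (n + 1), n.choose k * (n + k).choose k *
        ((k.choose j) ^ 2 * (2 * j).choose k) := by
  obtain ⟨m, rfl⟩ : ∃ m, n = j + m := ⟨n - j, by omega⟩
  rw [show j + m + 1 = j + (m + 1) by ring, Finset.sum_range_add, Finset.sum_eq_zero, zero_add]
  · have h := sum_choose_mul_choose_mul_choose_add m j (j + m + j) (by omega)
    have e : ∀ i, (j + m).choose (j + i) * (j + m + (j + i)).choose (j + i) *
        (((j + i).choose j) ^ 2 * (2 * j).choose (j + i)) =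
        ((2 * j).choose j * (j + m).choose j) *
          (m.choose i * j.choose i * (j + m + j + i).choose (m + j)) := by
      intro i
      rw [choose_sq_mul_choose]
      have h1 := Nat.choose_mul (n := j + m) (k := j + i) (s := j) (by omega)
      rw [show j + m - j = m by omega, show j + i - j = i by omega] at h1
      have h2 : (j + m + (j + i)).choose (j + i) = (j + m + j + i).choose (m + j) := by
        rw [← Nat.choose_symm (show j + i ≤ j + m + (j + i) by omega)]
        congr 1 <;> omega
      rw [h2]
      linear_combination ((2 * j).choose j * j.choose i * (j + m + j + i).choose (m + j)) * h1
    simp only [e]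
    rw [← Finset.mul_sum, h]
    have h3 := Nat.choose_mul (n := j + m + j) (k := 2 * j) (s := j) (by omega)
    rw [show j + m + j - j = j + m by omega, show 2 * j - j = j by omega] at h3
    have h4 : (j + m + j).choose (2 * j) = (j + m + j).choose m := by
      rw [← Nat.choose_symm (show m ≤ j + m + j by omega)]
      congr 1; omega
    rw [h4] at h3
    symm
    linear_combination ((j + m).choose j * (j + m + j).choose j) * h3
  · intro k hk
    rw [Finset.mem_range] at hk
    rw [Nat.choose_eq_zero_of_lt hk]; simp

theorem aperyNumber_eq_sum_franelNumber (n : ℕ) :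
    aperyNumber n = ∑ k ∈ Finset.range (n + 1), n.choose k * (n + k).choose k * franelNumber k := by
  unfold aperyNumber
  rw [Finset.sum_congr rfl fun j hj => apery_term_eq_sum n j (by rw [Finset.mem_range] at hj; omega),
    Finset.sum_comm]
  apply Finset.sum_congr rfl
  intro k hk
  rw [Finset.mem_range] at hk
  rw [franelNumber_eq_sum_range hk, Finset.mul_sum]

/-! ### The Apéry recurrence by creative telescoping. -/

/-- The summand `C(n,k)^2 C(n+k,k)^2` of the Apéry number, as a rational number. -/
def aperyTerm (n k : ℕ) : ℚ := ((n.choose k : ℚ) * ((n + k).choose k : ℚ)) ^ 2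

theorem aperyNumber_eq_sum_aperyTerm {n m : ℕ} (h : n < m) :
    (aperyNumber n : ℚ) = ∑ k ∈ Finset.range m, aperyTerm n k := by
  unfold aperyNumber
  push_cast
  have : ∀ k, (n.choose k : ℚ) ^ 2 * ((n + k).choose k : ℚ) ^ 2 = aperyTerm n k := by
    intro k; unfold aperyTerm; ring
  simp only [this]
  apply Finset.sum_subset (Finset.range_mono h)
  intro k _ hk
  rw [Finset.mem_range, not_lt] at hk
  unfold aperyTerm
  rw [Nat.choose_eq_zero_of_lt (by omega)]; simp

theorem choose_mul_choose_add_eq {n k : ℕ} (h : k ≤ n) :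
    (n.choose k : ℚ) * ((n + k).choose k : ℚ) =
      (n + k).factorial / ((n - k).factorial * (k.factorial : ℚ) ^ 2) := by
  have h1 : ((n - k).factorial : ℚ) ≠ 0 := by exact_mod_cast Nat.factorial_ne_zero _
  have h2 : (k.factorial : ℚ) ≠ 0 := by exact_mod_cast Nat.factorial_ne_zero _
  have h3 : (n.factorial : ℚ) ≠ 0 := by exact_mod_cast Nat.factorial_ne_zero _
  rw [Nat.cast_choose ℚ h, Nat.cast_choose ℚ (show k ≤ n + k by omega), Nat.add_sub_cancel]
  field_simp

/-- The telescoping certificate for the Apéry recurrence. -/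
def aperyCert (n k : ℕ) : ℚ :=
  4 * (2 * n + 3) * (k * (2 * k + 1) - (2 * n + 3) ^ 2) * aperyTerm (n + 1) k

theorem aperyTerm_recurrence_succ (n k : ℕ) (hk : k ≤ n + 1) :
    (n + 2 : ℚ) ^ 3 * aperyTerm (n + 2) (k + 1)
      - (2 * n + 3) * (17 * (n + 1) ^ 2 + 17 * (n + 1) + 5) * aperyTerm (n + 1) (k + 1)
      + (n + 1) ^ 3 * aperyTerm n (k + 1) = aperyCert n (k + 1) - aperyCert n k := by
  obtain ⟨m, hm⟩ : ∃ m, n + 1 = k + m := ⟨n + 1 - k, by omega⟩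
  have hmq : (n : ℚ) = k + m - 1 := by
    have : (n : ℚ) + 1 = k + m := by exact_mod_cast hm
    linarith
  -- Each binomial product needed is u times a polynomial, whose zeros also cover the degenerate
  -- cases m = 0, 1; the identity becomes a polynomial one.
  set u : ℚ := (n + k + 1).factorial / (m.factorial * ((k + 1).factorial : ℚ) ^ 2) with hu
  have hm0 : (m.factorial : ℚ) ≠ 0 := by exact_mod_cast Nat.factorial_ne_zero _
  have hk0 : (k.factorial : ℚ) ≠ 0 := by exact_mod_cast Nat.factorial_ne_zero _
  have hk1 : (k : ℚ) + 1 ≠ 0 := by positivity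
  have e0 : (n.choose (k + 1) : ℚ) * ((n + (k + 1)).choose (k + 1) : ℚ) = u * (m * (m - 1)) := by
    rcases Nat.lt_or_ge 1 m with h | h
    · obtain ⟨l, rfl⟩ : ∃ l, m = l + 2 := ⟨m - 2, by omega⟩
      rw [choose_mul_choose_add_eq (by omega), hu, show n - (k + 1) = l by omega,
        Nat.factorial_succ (l + 1), Nat.factorial_succ l, ← add_assoc]
      have hl0 : (l.factorial : ℚ) ≠ 0 := by exact_mod_cast Nat.factorial_ne_zero _
      push_cast
      field_simp
      ring
    · rw [Nat.choose_eq_zero_of_lt (by omega)]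
      interval_cases m <;> simp
  have e1 : ((n + 1).choose (k + 1) : ℚ) * ((n + 1 + (k + 1)).choose (k + 1) : ℚ) =
      u * ((n + k + 2) * m) := by
    rcases Nat.eq_zero_or_pos m with h | h
    · rw [Nat.choose_eq_zero_of_lt (by omega), h]; simp
    · obtain ⟨l, rfl⟩ : ∃ l, m = l + 1 := ⟨m - 1, by omega⟩
      rw [choose_mul_choose_add_eq (by omega), hu, show n + 1 - (k + 1) = l by omega,
        show n + 1 + (k + 1) = n + k + 1 + 1 by ring,
        Nat.factorial_succ (n + k + 1), Nat.factorial_succ l]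
      have hl0 : (l.factorial : ℚ) ≠ 0 := by exact_mod_cast Nat.factorial_ne_zero _
      push_cast
      field_simp
      ring
  have e2 : ((n + 2).choose (k + 1) : ℚ) * ((n + 2 + (k + 1)).choose (k + 1) : ℚ) =
      u * ((n + k + 2) * (n + k + 3)) := by
    rw [choose_mul_choose_add_eq (by omega), hu, show n + 2 - (k + 1) = m by omega,
      show n + 2 + (k + 1) = n + k + 1 + 1 + 1 by ring,
      Nat.factorial_succ (n + k + 1 + 1), Nat.factorial_succ (n + k + 1)]
    push_cast
    field_simp
    ring
  have e3 : ((n + 1).choose k : ℚ) * ((n + 1 + k).choose k : ℚ) = u * (k + 1) ^ 2 := by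
    rw [choose_mul_choose_add_eq (by omega), hu, show n + 1 - k = m by omega,
      show n + 1 + k = n + k + 1 by ring, Nat.factorial_succ k]
    push_cast
    field_simp
  unfold aperyCert aperyTerm
  rw [e0, e1, e2, e3, hmq]
  push_cast
  ring

theorem aperyTerm_recurrence_zero (n : ℕ) :
    (n + 2 : ℚ) ^ 3 * aperyTerm (n + 2) 0
      - (2 * n + 3) * (17 * (n + 1) ^ 2 + 17 * (n + 1) + 5) * aperyTerm (n + 1) 0
      + (n + 1) ^ 3 * aperyTerm n 0 = aperyCert n 0 := by
  simp [aperyTerm, aperyCert]; ring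

theorem aperyNumber_recurrence (n : ℕ) :
    (n + 2 : ℤ) ^ 3 * aperyNumber (n + 2)
      - (2 * n + 3) * (17 * (n + 1) ^ 2 + 17 * (n + 1) + 5) * aperyNumber (n + 1)
      + (n + 1) ^ 3 * aperyNumber n = 0 := by
  have tele : ∀ m, m ≤ n + 2 → ∑ k ∈ Finset.range (m + 1),
      ((n + 2 : ℚ) ^ 3 * aperyTerm (n + 2) k
      - (2 * n + 3) * (17 * (n + 1) ^ 2 + 17 * (n + 1) + 5) * aperyTerm (n + 1) k
      + (n + 1) ^ 3 * aperyTerm n k) = aperyCert n m := by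
    intro m
    induction m with
    | zero => intro _; simpa using aperyTerm_recurrence_zero n
    | succ m ih =>
      intro hm
      rw [Finset.sum_range_succ, ih (by omega), aperyTerm_recurrence_succ n m (by omega)]
      ring
  have h := tele (n + 2) le_rfl
  have hz : aperyCert n (n + 2) = 0 := by simp [aperyCert, aperyTerm]
  simp only [Finset.sum_add_distrib, Finset.sum_sub_distrib, ← Finset.mul_sum] at h
  rw [← aperyNumber_eq_sum_aperyTerm (by omega), ← aperyNumber_eq_sum_aperyTerm (by omega),
    ← aperyNumber_eq_sum_aperyTerm (by omega), hz] at h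
  exact_mod_cast h

/-! ### The case r = 0. -/

theorem alternating_sum_choose_add {k p : ℕ} :
    ∑ n ∈ Finset.range p, (2 * n + 1 : ℤ) * (-1) ^ n * ((n.choose k : ℤ) * ((n + k).choose k : ℤ)) =
      -(-1) ^ p * (p - k) * ((p.choose k : ℤ) * ((p + k).choose k : ℤ)) := by
  induction p with
  | zero => cases k <;> simp
  | succ p ih =>
    rw [Finset.sum_range_succ, ih]
    have h1 : ((p : ℤ) + 1 - k) * ((p + 1).choose k : ℤ) = (p + 1) * (p.choose k : ℤ) := by
      rcases Nat.lt_or_ge (p + 1) k with h | h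
      · rw [Nat.choose_eq_zero_of_lt h, Nat.choose_eq_zero_of_lt (show p < k by omega)]; simp
      · have := Nat.choose_mul_succ_eq p k
        zify [h] at this
        linarith
    have h2 : ((p : ℤ) + 1) * ((p + 1 + k).choose k : ℤ) = (p + k + 1) * ((p + k).choose k : ℤ) := by
      have := Nat.choose_mul_succ_eq (p + k) k
      rw [show p + k + 1 - k = p + 1 by omega, show p + k + 1 = p + 1 + k by ring] at this
      zify at this
      linarith
    rw [pow_succ]
    push_cast
    linear_combination (-(-1) ^ p * ((p + 1 + k).choose k : ℤ)) * h1
      - (-1) ^ p * (p.choose k : ℤ) * h2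

theorem factorial_sq_mul_choose_mul_choose_add (p k : ℕ) :
    (k.factorial : ℤ) ^ 2 * ((p - k) * ((p.choose k : ℤ) * ((p + k).choose k : ℤ))) =
      p * ∏ i ∈ Finset.range k, ((p : ℤ) ^ 2 - (i + 1) ^ 2) := by
  induction k with
  | zero => simp
  | succ k ih =>
    rw [Finset.prod_range_succ, ← mul_assoc (p : ℤ), ← ih, Nat.factorial_succ]
    have h1 : ((k : ℤ) + 1) * (p.choose (k + 1) : ℤ) = (p - k) * (p.choose k : ℤ) := by
      rcases Nat.lt_or_ge p k with h | h
      · rw [Nat.choose_eq_zero_of_lt h, Nat.choose_eq_zero_of_lt (show p < k + 1 by omega)]; simp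
      · have := Nat.choose_succ_right_eq p k
        zify [h] at this
        linarith
    have h2 : ((k : ℤ) + 1) * ((p + (k + 1)).choose (k + 1) : ℤ) =
        (p + k + 1) * ((p + k).choose k : ℤ) := by
      have := Nat.add_one_mul_choose_eq (p + k) k
      zify at this
      rw [← add_assoc]
      linarith
    push_cast
    linear_combination (k.factorial : ℤ) ^ 2 * (p - (k + 1)) *
      (((k : ℤ) + 1) * ((p + (k + 1)).choose (k + 1) : ℤ)) * h1 +
      (k.factorial : ℤ) ^ 2 * (p - (k + 1)) * ((p - k) * (p.choose k : ℤ)) * h2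

/-- Times k!^2, the left product is p ∏ (p^2 - i^2) over 1 ≤ i ≤ k, and the product is (-1)^k k!^2
mod p^2; k! is prime to p. -/
theorem choose_mul_choose_add_modEq {p k : ℕ} (hp : p.Prime) (hk : k < p) :
    (p : ℤ) ^ 3 ∣ (p - k) * ((p.choose k : ℤ) * ((p + k).choose k : ℤ)) - p * (-1) ^ k := by
  have hprod : ∀ k : ℕ, (p : ℤ) ^ 2 ∣ ∏ i ∈ Finset.range k, ((p : ℤ) ^ 2 - (i + 1) ^ 2) -
      (-1) ^ k * (k.factorial : ℤ) ^ 2 := by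
    intro k
    induction k with
    | zero => simp
    | succ k ih =>
      rw [Finset.prod_range_succ, Nat.factorial_succ, pow_succ (-1 : ℤ)]
      obtain ⟨c, hc⟩ := ih
      rw [sub_eq_iff_eq_add] at hc
      rw [hc]
      push_cast
      exact ⟨c * ((p : ℤ) ^ 2 - (k + 1) ^ 2) + (-1) ^ k * (k.factorial : ℤ) ^ 2, by ring⟩
  have hcop : IsCoprime ((p : ℤ) ^ 3) ((k.factorial : ℤ) ^ 2) := by
    apply IsCoprime.pow
    rw [Nat.isCoprime_iff_coprime]
    exact (hp.coprime_iff_not_dvd).2 fun h => by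
      have := (hp.dvd_factorial).1 h
      omega
  apply hcop.dvd_of_dvd_mul_left
  rw [mul_sub, factorial_sq_mul_choose_mul_choose_add]
  obtain ⟨c, hc⟩ := hprod k
  exact ⟨c, by linear_combination (p : ℤ) * hc⟩

theorem aperyNumber_eq_sum_range {n m : ℕ} (h : n < m) :
    aperyNumber n = ∑ k ∈ Finset.range m, n.choose k * (n + k).choose k * franelNumber k := by
  rw [aperyNumber_eq_sum_franelNumber]
  apply Finset.sum_subset (Finset.range_mono h)
  intro k _ hk
  rw [Finset.mem_range, not_lt] at hk
  rw [Nat.choose_eq_zero_of_lt (by omega)]; simp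

theorem sum_aperyNumber_modEq_sum_franelNumber {p : ℕ} (hp : p.Prime) (hodd : Odd p) :
    (p : ℤ) ^ 3 ∣ ∑ n ∈ Finset.range p, (2 * n + 1 : ℤ) * (-1) ^ n * (aperyNumber n : ℤ) -
      p * ∑ k ∈ Finset.range p, (-1 : ℤ) ^ k * (franelNumber k : ℤ) := by
  have h1 : ∑ n ∈ Finset.range p, (2 * n + 1 : ℤ) * (-1) ^ n * (aperyNumber n : ℤ) =
      ∑ k ∈ Finset.range p, ((p - k : ℤ) * ((p.choose k : ℤ) * ((p + k).choose k : ℤ))) *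
        (franelNumber k : ℤ) := by
    have e : ∀ n ∈ Finset.range p, (2 * n + 1 : ℤ) * (-1) ^ n * (aperyNumber n : ℤ) =
        ∑ k ∈ Finset.range p, (2 * n + 1 : ℤ) * (-1) ^ n *
          ((n.choose k : ℤ) * ((n + k).choose k : ℤ)) * (franelNumber k : ℤ) := by
      intro n hn
      rw [Finset.mem_range] at hn
      rw [aperyNumber_eq_sum_range hn]
      push_cast
      rw [Finset.mul_sum]
      apply Finset.sum_congr rfl
      intros; ring
    rw [Finset.sum_congr rfl e, Finset.sum_comm]
    apply Finset.sum_congr rfl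
    intro k _
    rw [← Finset.sum_mul, alternating_sum_choose_add, hodd.neg_one_pow]
    ring
  rw [h1, Finset.mul_sum, ← Finset.sum_sub_distrib]
  apply Finset.dvd_sum
  intro k hk
  rw [Finset.mem_range] at hk
  rw [← mul_assoc (p : ℤ), ← sub_mul]
  exact (choose_mul_choose_add_modEq hp hk).mul_right _

theorem sum_aperyNumber_modEq {p : ℕ} (hp : p.Prime) (h2 : p ≠ 2) :
    (p : ℤ) ^ 3 ∣ ∑ n ∈ Finset.range p, (2 * n + 1 : ℤ) * (-1) ^ n * (aperyNumber n : ℤ) -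
      p * legendreSym 3 p := by
  have h := dvd_add (alternating_sum_franelNumber_modEq hp) (sum_centralBinom_modEq hp h2)
  rw [sub_add_sub_cancel] at h
  have h' := dvd_add (sum_aperyNumber_modEq_sum_franelNumber hp (hp.odd_of_ne_two h2))
    (by simpa only [← pow_succ'] using mul_dvd_mul_left (p : ℤ) h)
  rwa [mul_sub, sub_add_sub_cancel] at h'

/-! ### Reduction of higher moments to r = 0. -/

-- The outer terms are q(m) and -q(-m), so only odd powers survive, doubled; q is monic, so the top
-- coefficient is 34 + 2 = 36.
open Polynomial in
theorem exists_int_coeff_even_reduction (r : ℕ) : ∃ a : ℕ → ℤ, ∀ m : ℤ,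
    (m - 1) ^ 3 * (m - 2) ^ (2 * r) + (34 * m ^ 3 + 6 * m) * m ^ (2 * r) +
      (m + 1) ^ 3 * (m + 2) ^ (2 * r) =
    36 * m ^ (2 * (r + 1) + 1) + ∑ j ∈ Finset.range (r + 1), a j * m ^ (2 * j + 1) := by
  set q : ℤ[X] := (X + C 1) ^ 3 * (X + C 2) ^ (2 * r) with hq
  have hmon : q.Monic := ((monic_X_add_C 1).pow 3).mul ((monic_X_add_C 2).pow _)
  have hdeg : q.natDegree = 2 * r + 3 := by
    rw [hq, Monic.natDegree_mul ((monic_X_add_C 1).pow 3) ((monic_X_add_C 2).pow _),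
      Monic.natDegree_pow (monic_X_add_C 1), Monic.natDegree_pow (monic_X_add_C 2),
      natDegree_X_add_C, natDegree_X_add_C]
    ring
  have hlead : q.coeff (2 * r + 3) = 1 := by rw [← hdeg]; exact hmon.coeff_natDegree
  have hpair : ∀ (f : ℕ → ℤ) (n : ℕ), ∑ i ∈ Finset.range (2 * n), f i =
      ∑ j ∈ Finset.range n, (f (2 * j) + f (2 * j + 1)) := by
    intro f n
    induction n with
    | zero => simp
    | succ n ih =>
      rw [Finset.sum_range_succ, ← ih, show 2 * (n + 1) = 2 * n + 1 + 1 by ring,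
        Finset.sum_range_succ, Finset.sum_range_succ]
      ring
  have heval : ∀ m : ℤ, (m + 1) ^ 3 * (m + 2) ^ (2 * r) =
      ∑ i ∈ Finset.range (2 * (r + 2)), q.coeff i * m ^ i := by
    intro m
    rw [← eval_eq_sum_range' (by rw [hdeg]; omega)]
    simp [hq]
  have hodd : ∀ m : ℤ, (m - 1) ^ 3 * (m - 2) ^ (2 * r) + (m + 1) ^ 3 * (m + 2) ^ (2 * r) =
      ∑ j ∈ Finset.range (r + 2), 2 * q.coeff (2 * j + 1) * m ^ (2 * j + 1) := by
    intro m
    have e : (m - 1) ^ 3 * (m - 2) ^ (2 * r) = -((-m + 1) ^ 3 * (-m + 2) ^ (2 * r)) := by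
      rw [show -m + 2 = -(m - 2) by ring, Even.neg_pow (even_two_mul r)]
      ring
    rw [e, heval, heval, ← Finset.sum_neg_distrib, ← Finset.sum_add_distrib, hpair]
    apply Finset.sum_congr rfl
    intro j _
    rw [Even.neg_pow (even_two_mul j), Odd.neg_pow (odd_two_mul_add_one j)]
    ring
  refine ⟨fun j => 2 * q.coeff (2 * j + 1) + if j = r then 6 else 0, fun m => ?_⟩
  have h := hodd m
  rw [Finset.sum_range_succ, show 2 * (r + 1) + 1 = 2 * r + 3 by ring, hlead] at h
  have h6 : ∑ j ∈ Finset.range (r + 1), (if j = r then (6 : ℤ) else 0) * m ^ (2 * j + 1) =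
      6 * m ^ (2 * r + 1) := by
    simp [ite_mul]
  simp only [add_mul, Finset.sum_add_distrib]
  rw [h6]
  have e : m ^ (2 * (r + 1) + 1) = m ^ (2 * r + 3) := by ring
  rw [e]
  linear_combination h

/-- `∑_{k<p} (2k+1)^{2r+1} (-1)^k A_k`. -/
def aperyMoment (p r : ℕ) : ℤ :=
  ∑ k ∈ Finset.range p, (2 * (k : ℤ) + 1) ^ (2 * r + 1) * (-1) ^ k * (aperyNumber k : ℤ)

/-- Summation by parts: the signs (-1)^k make the recurrence operator formally self-adjoint, and the
boundary term at k = p - 1 carries p^3. -/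
theorem sum_apery_operator (x : ℤ → ℤ) (p : ℕ) :
    (p : ℤ) ^ 3 ∣ ∑ k ∈ Finset.range p, ((k : ℤ) ^ 3 * x (k - 1) +
      (2 * k + 1) * (17 * k ^ 2 + 17 * k + 5) * x k + (k + 1) ^ 3 * x (k + 1)) *
        ((-1) ^ k * (aperyNumber k : ℤ)) := by
  have h : ∀ n : ℕ, ∑ k ∈ Finset.range (n + 1), ((k : ℤ) ^ 3 * x (k - 1) +
      (2 * k + 1) * (17 * k ^ 2 + 17 * k + 5) * x k + (k + 1) ^ 3 * x (k + 1)) *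
        ((-1) ^ k * (aperyNumber k : ℤ)) = (n + 1) ^ 3 * ((-1) ^ n *
          (x (n + 1) * aperyNumber n + x n * aperyNumber (n + 1))) := by
    intro n
    induction n with
    | zero =>
      have h0 : aperyNumber 0 = 1 := by decide
      have h1 : aperyNumber 1 = 5 := by decide
      simp [h0, h1]; ring
    | succ n ih =>
      rw [Finset.sum_range_succ, ih]
      have := aperyNumber_recurrence n
      push_cast
      rw [add_sub_cancel_right, pow_succ]
      linear_combination (-1) ^ n * x (n + 1) * this
  cases p with
  | zero => simp
  | succ n => rw [h n]; push_cast; exact dvd_mul_right _ _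

theorem aperyMoment_reduction (r : ℕ) : ∃ a : ℕ → ℤ, ∀ p : ℕ,
    (p : ℤ) ^ 3 ∣ 36 * aperyMoment p (r + 1) +
      ∑ j ∈ Finset.range (r + 1), a j * aperyMoment p j := by
  obtain ⟨a, ha⟩ := exists_int_coeff_even_reduction r
  refine ⟨a, fun p => ?_⟩
  -- The factor 8 clears denominators in m = 2k + 1: 8k^3 = (m-1)^3 and 8(2k+1)(17k^2+17k+5) = 34m^3
  -- + 6m.
  have h := (sum_apery_operator (fun k => (2 * k + 1) ^ (2 * r)) p).mul_left 8
  refine h.trans (dvd_of_eq ?_)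
  symm
  unfold aperyMoment
  simp only [Finset.mul_sum]
  rw [Finset.sum_comm, ← Finset.sum_add_distrib]
  apply Finset.sum_congr rfl
  intro k _
  have := ha (2 * k + 1)
  have e : ∑ j ∈ Finset.range (r + 1), a j * ((2 * (k : ℤ) + 1) ^ (2 * j + 1) * (-1) ^ k *
      (aperyNumber k : ℤ)) = (∑ j ∈ Finset.range (r + 1), a j * (2 * (k : ℤ) + 1) ^ (2 * j + 1)) *
      ((-1) ^ k * (aperyNumber k : ℤ)) := by
    rw [Finset.sum_mul]
    apply Finset.sum_congr rfl
    intros; ring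
  rw [e]
  have e1 : 2 * ((k : ℤ) - 1) + 1 = 2 * k + 1 - 2 := by ring
  have e2 : 2 * ((k : ℤ) + 1) + 1 = 2 * k + 1 + 2 := by ring
  rw [e1, e2]
  linear_combination -((-1) ^ k * (aperyNumber k : ℤ)) * this

theorem exists_padicInt_mul_eq_one {p : ℕ} [Fact p.Prime] (hp : 3 < p) :
    ∃ u : ℤ_[p], 36 * u = 1 := by
  have h : IsUnit ((36 : ℕ) : ℤ_[p]) := by
    rw [PadicInt.isUnit_iff, PadicInt.norm_natCast_eq_one_iff]
    have hpp : p.Prime := Fact.out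
    rw [hpp.coprime_iff_not_dvd, show 36 = (2 * 3) ^ 2 by norm_num]
    intro h
    rcases hpp.dvd_mul.1 (hpp.dvd_of_dvd_pow h) with h | h
    · have := Nat.le_of_dvd (by norm_num) h; omega
    · have := Nat.le_of_dvd (by norm_num) h; omega
  obtain ⟨u, hu⟩ := h.exists_right_inv
  exact ⟨u, by exact_mod_cast hu⟩

theorem exists_aperyMoment_modEq (r : ℕ) : ∃ c : ℚ, ∀ (p : ℕ) [Fact p.Prime], 3 < p →
    ∃ cp : ℤ_[p], (cp : ℚ_[p]) = (c : ℚ_[p]) ∧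
      (p : ℤ_[p]) ^ 3 ∣ (aperyMoment p r : ℤ_[p]) - cp * (aperyMoment p 0 : ℤ_[p]) := by
  induction r using Nat.strong_induction_on with
  | _ r ih =>
  cases r with
  | zero => exact ⟨1, fun p _ _ => ⟨1, by simp, by simp⟩⟩
  | succ r =>
    choose! c hc using ih
    obtain ⟨a, ha⟩ := aperyMoment_reduction r
    refine ⟨-(∑ j ∈ Finset.range (r + 1), a j * c j) / 36, fun p _ hp => ?_⟩
    have hcp : ∀ j, j < r + 1 → ∃ cp : ℤ_[p], (cp : ℚ_[p]) = (c j : ℚ_[p]) ∧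
      (p : ℤ_[p]) ^ 3 ∣ (aperyMoment p j : ℤ_[p]) - cp * (aperyMoment p 0 : ℤ_[p]) :=
      fun j hj => hc j hj p hp
    choose! d hd using hcp
    obtain ⟨u, hu⟩ := exists_padicInt_mul_eq_one hp
    refine ⟨-(u * ∑ j ∈ Finset.range (r + 1), (a j : ℤ_[p]) * d j), ?_, ?_⟩
    · have hu' : (36 : ℚ_[p]) * (u : ℚ_[p]) = 1 := by exact_mod_cast congrArg (Subtype.val) hu
      have hs : ((∑ j ∈ Finset.range (r + 1), (a j : ℤ_[p]) * d j : ℤ_[p]) : ℚ_[p]) =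
          ∑ j ∈ Finset.range (r + 1), (a j : ℚ_[p]) * (c j : ℚ_[p]) := by
        rw [PadicInt.coe_sum]
        apply Finset.sum_congr rfl
        intro j hj
        rw [Finset.mem_range] at hj
        rw [PadicInt.coe_mul, (hd j hj).1, PadicInt.coe_intCast]
      push_cast
      rw [hs, eq_div_iff (by norm_num)]
      linear_combination (-∑ j ∈ Finset.range (r + 1), (a j : ℚ_[p]) * (c j : ℚ_[p])) * hu'
    · have h1 : (p : ℤ_[p]) ^ 3 ∣ 36 * (aperyMoment p (r + 1) : ℤ_[p]) +
          ∑ j ∈ Finset.range (r + 1), (a j : ℤ_[p]) * (aperyMoment p j : ℤ_[p]) := by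
        have := map_dvd (Int.castRingHom ℤ_[p]) (ha p)
        simpa using this
      have h2 : (p : ℤ_[p]) ^ 3 ∣ ∑ j ∈ Finset.range (r + 1),
          (a j : ℤ_[p]) * ((aperyMoment p j : ℤ_[p]) - d j * (aperyMoment p 0 : ℤ_[p])) := by
        apply Finset.dvd_sum
        intro j hj
        rw [Finset.mem_range] at hj
        exact (hd j hj).2.mul_left _
      have h3 := (dvd_sub h1 h2).mul_left u
      convert h3 using 1
      have e : ∑ j ∈ Finset.range (r + 1),
          (a j : ℤ_[p]) * ((aperyMoment p j : ℤ_[p]) - d j * (aperyMoment p 0 : ℤ_[p])) =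
          ∑ j ∈ Finset.range (r + 1), (a j : ℤ_[p]) * (aperyMoment p j : ℤ_[p]) -
          (∑ j ∈ Finset.range (r + 1), (a j : ℤ_[p]) * d j) * (aperyMoment p 0 : ℤ_[p]) := by
        rw [Finset.sum_mul, ← Finset.sum_sub_distrib]
        apply Finset.sum_congr rfl
        intros; ring
      rw [e]
      linear_combination -(aperyMoment p (r + 1) : ℤ_[p]) * hu

theorem mainTheorem5 :
    ∀ r : ℕ, ∃ c : ℚ, ∀ (p : ℕ) [Fact p.Prime], 3 < p →
      ∃ cp : ℤ_[p], (cp : ℚ_[p]) = (c : ℚ_[p]) ∧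
        (p : ℤ_[p]) ^ 3 ∣
          (∑ k ∈ Finset.range p,
              (2 * (k : ℤ_[p]) + 1) ^ (2 * r + 1) * (-1) ^ k * (aperyNumber k : ℤ_[p])) -
            cp * (p : ℤ_[p]) * ((legendreSym 3 (p : ℤ) : ℤ) : ℤ_[p]) := by
  intro r
  obtain ⟨c, hc⟩ := exists_aperyMoment_modEq r
  refine ⟨c, fun p _ hp => ?_⟩
  obtain ⟨cp, hcp, hdvd⟩ := hc p hp
  refine ⟨cp, hcp, ?_⟩
  have h0 := map_dvd (Int.castRingHom ℤ_[p]) (sum_aperyNumber_modEq (Fact.out : p.Prime) (by omega))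
  have e : (aperyMoment p 0 : ℤ_[p]) = Int.castRingHom ℤ_[p]
      (∑ n ∈ Finset.range p, (2 * n + 1 : ℤ) * (-1) ^ n * (aperyNumber n : ℤ)) := by
    simp [aperyMoment]
  rw [map_sub, ← e, map_pow, map_mul] at h0
  simp only [eq_intCast, Int.cast_natCast] at h0
  have h1 := dvd_add hdvd (h0.mul_left cp)
  convert h1 using 1
  simp only [aperyMoment]
  push_cast
  ring
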